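/- Let $d\ge 1$ and $r>0$. Let $S^{d-1}$ be the unit sphere of $\mathbb{R}^d$ with the spherical Lebesgue measure $\mathrm{d}u$, and for $v_1,\dots,v_d\in\mathbb{R}^d$ let $\nabla_d(v_1,\dots,v_d)$ be the $d$-dimensional volume of the parallelotope spanned by $v_1,\dots,v_d$. Let $$T:\mathbb{R}^d\times(S^{d-1})^d\to(\mathbb{R}^d)^d,\qquad T(z,u_1,\dots,u_d)=(z+ru_1,\dots,z+ru_d).$$ Let $D\subset\mathbb{R}^d\times(S^{d-1})^d$ be a measurable set such that $T$ is injective on $D\setminus N$ for some set $N$ of measure zero; here measurability and measure zero refer to the (completed) product of the Lebesgue measure on $\mathbb{R}^d$ and the spherical Lebesgue measures. Then for every non-negative Lebesgue measurable function $f:(\mathbb{R}^d)^d\to\mathbb{R}$, $$\int_{T(D)} f(x_1,\dots,x_d)\,\mathrm{d}(x_1,\dots,x_d) =r^{d(d-1)}\int_{\mathbb{R}^d}\int_{S^{d-1}}\cdots\int_{S^{d-1}}\mathbf{1}\big((z,u_1,\dots,u_d)\in D\big)\,f(z+ru_1,\dots,z+ru_d)\,\nabla_d(u_1,\dots,u_d)\,\mathrm{d}u_1\cdots\mathrm{d}u_d\,\mathrm{d}z,$$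 as an identity in $[0,\infty]$, where the left-hand side is the integral over the set $T(D)\subset(\mathbb{R}^d)^d$ with respect to Lebesgue measure. -/

import Mathlib

open MeasureTheory
open scoped ENNReal

noncomputable section

/-- Euclidean space `ℝ^d` with its usual norm. -/
abbrev RSpace (d : ℕ) : Type := EuclideanSpace ℝ (Fin d)

/-- The unit sphere `S^{d-1}` of `ℝ^d`. -/
abbrev USphere (d : ℕ) : Type := Metric.sphere (0 : RSpace d) 1

/-- The spherical Lebesgue measure `σ_{d-1}` on `S^{d-1}`: the measure of `A` is `d` times the
Lebesgue measure of the cone `{t • u | 0 < t < 1, u ∈ A}`; the total mass is `d κ_d`. -/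
def sphereMeasure (d : ℕ) : Measure (USphere d) :=
  (volume : Measure (RSpace d)).toSphere

/-- The product measure `σ_{d-1} ⊗ ⋯ ⊗ σ_{d-1}` on `(S^{d-1})^d`. -/
def sphereProdMeasure (d : ℕ) : Measure (Fin d → USphere d) :=
  Measure.pi fun _ => sphereMeasure d

/-- `∇_d(v_1, …, v_d)`: the `d`-dimensional volume of the parallelotope
`{∑ i, t_i v_i | 0 ≤ t_i ≤ 1}` spanned by `v_1, …, v_d`. -/
def nablaVol (d : ℕ) (v : Fin d → RSpace d) : ℝ≥0∞ :=
  volume (parallelepiped v)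

/-- The map `T(z, u_1, …, u_d) = (z + r u_1, …, z + r u_d)`. -/
def sphereMap (d : ℕ) (r : ℝ) (p : RSpace d × (Fin d → USphere d)) : Fin d → RSpace d :=
  fun i => p.1 + r • (p.2 i : RSpace d)

end

/-! The map T is lifted to a map between Euclidean spaces of dimension d + d². Polar coordinates
replace each u i by x i = ρ i u i, and `radialMap` records ρ i ^ d alongside T. Its Jacobian is
r^(d(d-1)) d^d ∇_d(u), independent of the radii (`abs_det_radialMap`). With all radii in (0,1), a
set D lifts to a set whose image is the unit cube times T(D) (`image_radialMap_polarMap`). The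
Euclidean change of variables then gives the formula for Borel data: the cube has volume 1, and the
radial mass d^(-d) cancels d^d (`lintegral_image_sphereMap`). For completed measurability, two
null-set facts suffice: T maps null sets to null sets, and preimages of null sets are null where ∇_d
≠ 0. -/

/-! ### Linear algebra of the Jacobian -/

section Shear

variable {R M N : Type*} [CommRing R] [AddCommGroup M] [Module R M] [AddCommGroup N] [Module R N]

/-- The shear `(x, y) ↦ (x, y + f x)`. -/
noncomputable def shearSnd (f : M →ₗ[R] N) : (M × N) →ₗ[R] (M × N) :=
  (LinearMap.fst R M N).prod (LinearMap.snd R M N + f ∘ₗ LinearMap.fst R M N)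

/-- The shear `(x, y) ↦ (x + f y, y)`. -/
noncomputable def shearFst (f : N →ₗ[R] M) : (M × N) →ₗ[R] (M × N) :=
  (LinearMap.fst R M N + f ∘ₗ LinearMap.snd R M N).prod (LinearMap.snd R M N)

theorem shearSnd_apply (f : M →ₗ[R] N) (p : M × N) : shearSnd f p = (p.1, p.2 + f p.1) := rfl

variable [Module.Free R M] [Module.Finite R M] [Module.Free R N] [Module.Finite R N]

theorem det_shearSnd (f : M →ₗ[R] N) : LinearMap.det (shearSnd f) = 1 := by
  classical
  let b := Module.Free.chooseBasis R M
  let b' := Module.Free.chooseBasis R N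
  have h : LinearMap.toMatrix (b.prod b') (b.prod b') (shearSnd f) =
      Matrix.fromBlocks 1 0 (LinearMap.toMatrix b b' f) 1 := by
    ext (i | i) (j | j) <;>
      simp [LinearMap.toMatrix, Matrix.one_apply, Finsupp.single_apply, eq_comm, shearSnd]
  rw [← LinearMap.det_toMatrix (b.prod b'), h, Matrix.det_fromBlocks_zero₁₂]
  simp

theorem det_shearFst (f : N →ₗ[R] M) : LinearMap.det (shearFst f) = 1 := by
  classical
  let b := Module.Free.chooseBasis R M
  let b' := Module.Free.chooseBasis R N
  have h : LinearMap.toMatrix (b.prod b') (b.prod b') (shearFst f) =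
      Matrix.fromBlocks 1 (LinearMap.toMatrix b' b f) 0 1 := by
    ext (i | i) (j | j) <;>
      simp [LinearMap.toMatrix, Matrix.one_apply, Finsupp.single_apply, eq_comm, shearFst]
  rw [← LinearMap.det_toMatrix (b.prod b'), h, Matrix.det_fromBlocks_zero₂₁]
  simp

end Shear

/-- The linear map `y ↦ (⟨u i, y⟩)_i`. -/
noncomputable def innerRows {d : ℕ} (u : Fin d → RSpace d) : RSpace d →ₗ[ℝ] RSpace d where
  toFun y := WithLp.toLp 2 fun i => inner ℝ (u i) y
  map_add' x y := by ext i; simp [inner_add_right]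
  map_smul' c x := by ext i; simp [inner_smul_right]

theorem nablaVol_eq {d : ℕ} (u : Fin d → RSpace d) :
    nablaVol d u = ENNReal.ofReal |LinearMap.det (innerRows u)| := by
  rw [nablaVol, ← (EuclideanSpace.basisFun (Fin d) ℝ).addHaar_eq_volume,
    Measure.addHaar_parallelepiped, Module.Basis.det_apply, ← Matrix.det_transpose,
    ← LinearMap.det_toMatrix (EuclideanSpace.basisFun (Fin d) ℝ).toBasis]
  congr 3
  ext i j
  simp [LinearMap.toMatrix_apply, Module.Basis.toMatrix_apply, innerRows,
    EuclideanSpace.inner_single_right]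

/-- The linear map which is the identity on the line spanned by the unit vector `u`, and
multiplication by `a` on its orthogonal complement. -/
noncomputable def dilateOrthogonal {d : ℕ} (a : ℝ) (u : RSpace d) : RSpace d →ₗ[ℝ] RSpace d :=
  a • LinearMap.id + ((1 - a) • (innerₛₗ ℝ u)).smulRight u

/-- Up to the factor a this is a transvection of determinant 1 + (1 - a)/a = 1/a, so the determinant
is a^d / a. -/
theorem det_dilateOrthogonal {d : ℕ} {a : ℝ} (ha : a ≠ 0) {u : RSpace d} (hu : ‖u‖ = 1) :
    LinearMap.det (dilateOrthogonal a u) = a ^ (d - 1) := by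
  have hd : d ≠ 0 := by
    rintro rfl
    simp [Subsingleton.elim u 0] at hu
  have h : dilateOrthogonal a u =
      a • LinearMap.transvection (innerₛₗ ℝ u) (((1 - a) / a) • u) := by
    ext1 y
    simp only [dilateOrthogonal, LinearMap.add_apply, LinearMap.smul_apply, LinearMap.id_apply,
      LinearMap.smulRight_apply, LinearMap.transvection.apply, smul_add, smul_smul]
    congr 2
    simp only [smul_eq_mul]
    field_simp
  obtain ⟨n, rfl⟩ := Nat.exists_eq_succ_of_ne_zero hd
  rw [h, LinearMap.det_smul, LinearMap.transvection.det]
  simp [hu, pow_succ]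
  field_simp
  simp

/-- The linear map `s ↦ (s i • u i)_i`. -/
noncomputable def smulVectors {d : ℕ} (u : Fin d → RSpace d) : RSpace d →ₗ[ℝ] (Fin d → RSpace d) where
  toFun s := fun i => s i • u i
  map_add' x y := by ext i; simp [add_mul]
  map_smul' c x := by ext i; simp [mul_assoc]

/-- The linear map `w ↦ (⟨u i, w i⟩)_i`. -/
noncomputable def innerDiag {d : ℕ} (u : Fin d → RSpace d) : (Fin d → RSpace d) →ₗ[ℝ] RSpace d where
  toFun w := WithLp.toLp 2 fun i => inner ℝ (u i) (w i)
  map_add' x y := by ext i; simp [inner_add_right]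
  map_smul' c x := by ext i; simp [inner_smul_right]

/-- Shape of the derivative of `radialMap`. Dilate each y i orthogonally to u i, add z, and call the
result w i. Then ⟨u i, w i⟩ - ⟨u i, z⟩ = ⟨u i, y i⟩, so z can be traded for the radial components by
`-innerRows u` and a shear. Another shear removes these components from w, and c rescales them. The
shears have determinant 1. -/
theorem abs_det_eq_of_apply {d : ℕ} (u : Fin d → RSpace d) (hu : ∀ i, ‖u i‖ = 1)
    (a : Fin d → ℝ) (ha : ∀ i, a i ≠ 0) (c : Fin d → ℝ)
    (L : (RSpace d × (Fin d → RSpace d)) →ₗ[ℝ] (RSpace d × (Fin d → RSpace d)))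
    (hL : ∀ z y, L (z, y) = (WithLp.toLp 2 fun i => c i * inner ℝ (u i) (y i),
      fun i => z + a i • (y i - (inner ℝ (u i) (y i) : ℝ) • u i))) :
    |LinearMap.det L| =
      |∏ i, c i| * |LinearMap.det (innerRows u)| * |∏ i, a i ^ (d - 1)| := by
  let C : RSpace d →ₗ[ℝ] RSpace d :=
    { toFun := fun s => WithLp.toLp 2 fun i => c i * s i
      map_add' := fun x y => by ext i; simp [mul_add]
      map_smul' := fun t x => by ext i; simp [mul_left_comm] }
  have hdet : LinearMap.det C = ∏ i, c i := by
    rw [← LinearMap.det_toMatrix (EuclideanSpace.basisFun (Fin d) ℝ).toBasis,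
      ← Matrix.det_diagonal]
    congr 1
    ext i j
    simp [C, LinearMap.toMatrix_apply, Matrix.diagonal_apply]
  have key : L = (C.prodMap LinearMap.id) ∘ₗ shearSnd (-smulVectors u) ∘ₗ
      shearFst (innerDiag u) ∘ₗ ((-innerRows u).prodMap LinearMap.id) ∘ₗ
      shearSnd (LinearMap.pi fun _ => LinearMap.id) ∘ₗ
      (LinearMap.id.prodMap (LinearMap.pi fun i =>
        (dilateOrthogonal (a i) (u i)).comp (LinearMap.proj i))) := by
    refine LinearMap.ext fun p => ?_
    obtain ⟨z, y⟩ := p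
    have h1 : ∀ i, inner ℝ (u i) (dilateOrthogonal (a i) (u i) (y i)) = inner ℝ (u i) (y i) := by
      intro i
      simp [dilateOrthogonal, inner_add_right, inner_smul_right, hu]
      ring
    have h2 : -innerRows u z + innerDiag u (fun i => dilateOrthogonal (a i) (u i) (y i) + z) =
        WithLp.toLp 2 fun i => inner ℝ (u i) (y i) := by
      ext i
      simp only [innerRows, innerDiag, LinearMap.coe_mk, AddHom.coe_mk,
        PiLp.add_apply, PiLp.neg_apply, inner_add_right, h1]
      ring
    have h3 : (shearFst (innerDiag u) ∘ₗ ((-innerRows u).prodMap LinearMap.id) ∘ₗ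
        shearSnd (LinearMap.pi fun _ => LinearMap.id) ∘ₗ
        (LinearMap.id.prodMap (LinearMap.pi fun i =>
          (dilateOrthogonal (a i) (u i)).comp (LinearMap.proj i)))) (z, y) =
        (WithLp.toLp 2 fun i => inner ℝ (u i) (y i),
          fun i => dilateOrthogonal (a i) (u i) (y i) + z) := by
      rw [← h2]; rfl
    rw [hL, LinearMap.comp_apply, LinearMap.comp_apply, h3, shearSnd_apply]
    refine Prod.ext rfl (funext fun i => ?_)
    change z + a i • (y i - (inner ℝ (u i) (y i) : ℝ) • u i) =
      (a i • y i + ((1 - a i) * (inner ℝ (u i) (y i) : ℝ)) • u i) + z +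
        -((inner ℝ (u i) (y i) : ℝ) • u i)
    module
  rw [key]
  simp only [LinearMap.det_comp, LinearMap.det_prodMap, det_shearSnd, det_shearFst,
    LinearMap.det_id, LinearMap.det_pi, det_dilateOrthogonal (ha _) (hu _), one_mul, mul_one,
    abs_mul, hdet]
  rw [← neg_one_smul ℝ (innerRows u), LinearMap.det_smul, abs_mul]
  simp [mul_assoc]

/-! ### Derivative and Jacobian of the radial extension -/

theorem hasStrictFDerivAt_norm_of_ne_zero {V : Type*} [NormedAddCommGroup V]
    [InnerProductSpace ℝ V] {x : V} (hx : x ≠ 0) :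
    HasStrictFDerivAt (fun y : V => ‖y‖) (‖x‖⁻¹ • innerSL ℝ x) x := by
  have h := (hasStrictFDerivAt_norm_sq x).sqrt (pow_ne_zero 2 (norm_ne_zero_iff.2 hx))
  simp only [Real.sqrt_sq (norm_nonneg _)] at h
  convert! h using 1
  ext y
  simp
  field_simp

/-- The map `(z, x) ↦ ((‖x i‖ ^ d)_i, (z + r x i / ‖x i‖)_i)`, which extends
`(z, u) ↦ (z + r u i)_i` by radial coordinates. -/
noncomputable def radialMap (d : ℕ) (r : ℝ) (p : RSpace d × (Fin d → RSpace d)) :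
    RSpace d × (Fin d → RSpace d) :=
  (WithLp.toLp 2 fun i => ‖p.2 i‖ ^ d, fun i => p.1 + (r * ‖p.2 i‖⁻¹) • p.2 i)

theorem exists_hasStrictFDerivAt_radialMap {d : ℕ} {r : ℝ}
    (p : RSpace d × (Fin d → RSpace d)) (hp : ∀ i, p.2 i ≠ 0) :
    ∃ L : (RSpace d × (Fin d → RSpace d)) →L[ℝ] (RSpace d × (Fin d → RSpace d)),
      HasStrictFDerivAt (radialMap d r) L p ∧ ∀ z y, L (z, y) =
        (WithLp.toLp 2 fun i => (d * ‖p.2 i‖ ^ (d - 1)) * inner ℝ (‖p.2 i‖⁻¹ • p.2 i) (y i),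
          fun i => z + (r * ‖p.2 i‖⁻¹) • (y i - (inner ℝ (‖p.2 i‖⁻¹ • p.2 i) (y i) : ℝ) •
            (‖p.2 i‖⁻¹ • p.2 i))) := by
  have hproj : ∀ i, HasStrictFDerivAt (fun q : RSpace d × (Fin d → RSpace d) => q.2 i)
      ((ContinuousLinearMap.proj i).comp (ContinuousLinearMap.snd ℝ _ _)) p := fun i =>
    ((ContinuousLinearMap.proj i).comp
      (ContinuousLinearMap.snd ℝ (RSpace d) (Fin d → RSpace d))).hasStrictFDerivAt
  have hnorm := fun i => (hasStrictFDerivAt_norm_of_ne_zero (hp i)).comp p (hproj i)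
  have h1 : ∀ i, HasStrictFDerivAt (fun q : RSpace d × (Fin d → RSpace d) => ‖q.2 i‖ ^ d) _ p :=
    fun i => (hnorm i).pow d
  have hinv : ∀ i, HasStrictFDerivAt (fun q : RSpace d × (Fin d → RSpace d) => r * ‖q.2 i‖⁻¹) _ p :=
    fun i => ((hasStrictDerivAt_inv (norm_ne_zero_iff.2 (hp i))).comp_hasStrictFDerivAt p
      (hnorm i)).const_mul r
  have h2 : ∀ i, HasStrictFDerivAt (fun q : RSpace d × (Fin d → RSpace d) =>
      q.1 + (r * ‖q.2 i‖⁻¹) • q.2 i) _ p :=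
    fun i => hasStrictFDerivAt_fst.add ((hinv i).smul (hproj i))
  have h1' : HasStrictFDerivAt (fun q : RSpace d × (Fin d → RSpace d) =>
      (WithLp.toLp 2 fun i => ‖q.2 i‖ ^ d : RSpace d)) _ p :=
    ((PiLp.continuousLinearEquiv 2 ℝ fun _ : Fin d => ℝ).symm.hasStrictFDerivAt).comp p
      (hasStrictFDerivAt_pi.2 h1)
  refine ⟨_, h1'.prodMk (hasStrictFDerivAt_pi.2 h2), fun z y => ?_⟩
  have hn : ∀ i, ‖p.2 i‖ ≠ 0 := fun i => norm_ne_zero_iff.2 (hp i)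
  refine Prod.ext ?_ (funext fun i => ?_)
  · ext i
    simp [inner_smul_left]
  · simp [inner_smul_left, smul_sub, smul_smul]
    rw [sub_eq_add_neg, ← neg_smul]
    congr 3
    field_simp
    rw [neg_smul]

theorem abs_det_radialMap {d : ℕ} {r : ℝ} (hr : 0 < r)
    (p : RSpace d × (Fin d → RSpace d)) (hp : ∀ i, p.2 i ≠ 0) :
    ∃ L : (RSpace d × (Fin d → RSpace d)) →L[ℝ] (RSpace d × (Fin d → RSpace d)),
      HasStrictFDerivAt (radialMap d r) L p ∧ ENNReal.ofReal |L.det| =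
        ENNReal.ofReal (r ^ (d * (d - 1)) * d ^ d) * nablaVol d fun i => ‖p.2 i‖⁻¹ • p.2 i := by
  obtain ⟨L, hL, hLa⟩ := exists_hasStrictFDerivAt_radialMap (r := r) p hp
  refine ⟨L, hL, ?_⟩
  have hn : ∀ i, 0 < ‖p.2 i‖ := fun i => norm_pos_iff.2 (hp i)
  have h := abs_det_eq_of_apply (fun i => ‖p.2 i‖⁻¹ • p.2 i)
    (fun i => norm_smul_inv_norm (𝕜 := ℝ) (hp i)) (fun i => r * ‖p.2 i‖⁻¹)
    (fun i => (mul_pos hr (inv_pos.2 (hn i))).ne') (fun i => d * ‖p.2 i‖ ^ (d - 1)) L hLa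
  rw [nablaVol_eq, ← ENNReal.ofReal_mul (by positivity), ContinuousLinearMap.det, h]
  congr 1
  rw [mul_right_comm, ← abs_mul, ← Finset.prod_mul_distrib]
  congr 1
  -- The exponent d in `radialMap` is chosen for this cancellation of the radii.
  have : ∀ i, (d * ‖p.2 i‖ ^ (d - 1)) * (r * ‖p.2 i‖⁻¹) ^ (d - 1) = d * r ^ (d - 1) := by
    intro i
    have := (hn i).ne'
    rw [mul_assoc, ← mul_pow, mul_left_comm, mul_inv_cancel₀ this, mul_one]
  simp only [this]
  rw [abs_of_nonneg (by positivity)]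
  simp [mul_pow, ← pow_mul, mul_comm]

/-! ### Preimages of null sets under local diffeomorphisms -/

/-- By the inverse function theorem the preimage is locally a differentiable image of a null set,
hence locally null, hence null. -/
theorem measure_inter_preimage_eq_zero_of_det_ne_zero {E : Type*} [NormedAddCommGroup E]
    [NormedSpace ℝ E] [FiniteDimensional ℝ E] [MeasurableSpace E] [BorelSpace E]
    (μ : Measure E) [μ.IsAddHaarMeasure] {f : E → E} {f' : E → E →L[ℝ] E} {s B : Set E}
    (hf : ∀ x ∈ s, HasStrictFDerivAt f (f' x) x) (hdet : ∀ x ∈ s, (f' x).det ≠ 0)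
    (hB : μ B = 0) : μ (s ∩ f ⁻¹' B) = 0 := by
  refine measure_null_of_locally_null _ fun x hx => ?_
  have hs : ∀ (y : E) (hy : y ∈ s), HasStrictFDerivAt f
      ((f' y).toContinuousLinearEquivOfDetNeZero (hdet y hy) : E →L[ℝ] E) y := fun y hy => by
    simpa using hf y hy
  let φ := (hs x hx.1).toOpenPartialHomeomorph f
  have hφ : ∀ y, φ y = f y := fun y => rfl
  have hxφ : x ∈ φ.source := (hs x hx.1).mem_toOpenPartialHomeomorph_source
  refine ⟨φ.source ∩ (s ∩ f ⁻¹' B), ?_, ?_⟩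
  · exact Filter.inter_mem (mem_nhdsWithin_of_mem_nhds (φ.open_source.mem_nhds hxφ))
      self_mem_nhdsWithin
  · have hsub : φ.source ∩ (s ∩ f ⁻¹' B) ⊆ φ.symm '' (B ∩ f '' (φ.source ∩ s)) := by
      rintro y ⟨hy, hys, hyB⟩
      exact ⟨f y, ⟨hyB, y, ⟨hy, hys⟩, rfl⟩, φ.left_inv hy⟩
    refine measure_mono_null hsub (addHaar_image_eq_zero_of_differentiableOn_of_addHaar_eq_zero μ
      ?_ (measure_mono_null Set.inter_subset_left hB))
    rintro _ ⟨-, y, ⟨hy, hys⟩, rfl⟩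
    have hy' : φ.symm (f y) = y := φ.left_inv hy
    refine (φ.hasFDerivAt_symm (f' := (f' y).toContinuousLinearEquivOfDetNeZero (hdet y hys))
      (φ.map_source hy) ?_).differentiableAt.differentiableWithinAt
    rw [hφ, hy']
    exact (hs y hys).hasFDerivAt

theorem hasStrictFDerivAt_radialMap {d : ℕ} {r : ℝ} (hr : 0 < r)
    (p : RSpace d × (Fin d → RSpace d)) (hp : ∀ i, p.2 i ≠ 0) :
    HasStrictFDerivAt (radialMap d r) (fderiv ℝ (radialMap d r) p) p := by
  obtain ⟨L, hL, -⟩ := abs_det_radialMap hr p hp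
  rwa [hL.hasFDerivAt.fderiv]

theorem abs_det_fderiv_radialMap {d : ℕ} {r : ℝ} (hr : 0 < r)
    (p : RSpace d × (Fin d → RSpace d)) (hp : ∀ i, p.2 i ≠ 0) :
    ENNReal.ofReal |(fderiv ℝ (radialMap d r) p).det| =
      ENNReal.ofReal (r ^ (d * (d - 1)) * d ^ d) * nablaVol d fun i => ‖p.2 i‖⁻¹ • p.2 i := by
  obtain ⟨L, hL, h⟩ := abs_det_radialMap hr p hp
  rwa [hL.hasFDerivAt.fderiv]

/-! ### Polar coordinates and the unit cube -/

/-- Polar coordinates in each of the last `d` components. -/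
noncomputable def polarMap (d : ℕ)
    (q : (RSpace d × (Fin d → USphere d)) × (Fin d → Set.Ioi (0 : ℝ))) :
    RSpace d × (Fin d → RSpace d) :=
  (q.1.1, fun i => (q.2 i : ℝ) • (q.1.2 i : RSpace d))

/-- The product of the radial measures `ρ ^ (d - 1) dρ`. -/
noncomputable def radialMeasure (d : ℕ) : Measure (Fin d → Set.Ioi (0 : ℝ)) :=
  Measure.pi fun _ => Measure.volumeIoiPow (d - 1)

instance (d : ℕ) : SigmaFinite (radialMeasure d) := by
  unfold radialMeasure; infer_instance

instance (d : ℕ) : IsFiniteMeasure (sphereMeasure d) := by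
  unfold sphereMeasure; infer_instance

instance (d : ℕ) : SigmaFinite (sphereProdMeasure d) := by
  unfold sphereProdMeasure; infer_instance

theorem measurePreserving_smul_sphere {d : ℕ} (hd : 1 ≤ d) :
    MeasurePreserving (fun q : USphere d × Set.Ioi (0 : ℝ) => (q.2 : ℝ) • (q.1 : RSpace d))
      ((sphereMeasure d).prod (Measure.volumeIoiPow (d - 1))) volume := by
  have : Nontrivial (RSpace d) := by
    have : Nonempty (Fin d) := ⟨⟨0, hd⟩⟩
    infer_instance
  have h := (volume : Measure (RSpace d)).measurePreserving_homeomorphUnitSphereProd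
  rw [finrank_euclideanSpace_fin] at h
  have h1 := MeasurePreserving.symm (homeomorphUnitSphereProd (RSpace d)).toMeasurableEquiv h
  have h2 : MeasurePreserving (Subtype.val : ({0}ᶜ : Set (RSpace d)) → RSpace d)
      (volume.comap Subtype.val) volume := by
    refine ⟨measurable_subtype_coe, ?_⟩
    rw [map_comap_subtype_coe (measurableSet_singleton _).compl, restrict_compl_singleton]
  exact h2.comp h1

theorem measurePreserving_polarMap {d : ℕ} (hd : 1 ≤ d) :
    MeasurePreserving (polarMap d)
      ((volume.prod (sphereProdMeasure d)).prod (radialMeasure d)) volume := by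
  have h1 := (measurePreserving_arrowProdEquivProdArrow (USphere d) (Set.Ioi (0 : ℝ)) (Fin d)
    (fun _ => sphereMeasure d) (fun _ => Measure.volumeIoiPow (d - 1))).symm
  have h2 := measurePreserving_pi
    (fun _ : Fin d => (sphereMeasure d).prod (Measure.volumeIoiPow (d - 1)))
    (fun _ => (volume : Measure (RSpace d))) (fun _ => measurePreserving_smul_sphere hd)
  have h3 : MeasurePreserving MeasurableEquiv.prodAssoc
      (((volume : Measure (RSpace d)).prod (sphereProdMeasure d)).prod (radialMeasure d))
      (volume.prod ((sphereProdMeasure d).prod (radialMeasure d))) :=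
    measurePreserving_prodAssoc _ _ _
  exact ((MeasurePreserving.id (volume : Measure (RSpace d))).prod (h2.comp h1)).comp h3

theorem polarMap_injective (d : ℕ) : Function.Injective (polarMap d) := by
  rintro ⟨⟨z, u⟩, ρ⟩ ⟨⟨z', u'⟩, ρ'⟩ h
  obtain ⟨h1, h2⟩ := Prod.ext_iff.1 h
  obtain rfl : z = z' := h1
  have hi : ∀ i, (ρ i : ℝ) • (u i : RSpace d) = (ρ' i : ℝ) • (u' i : RSpace d) :=
    fun i => congrFun h2 i
  have hρ : ρ = ρ' := by
    funext i
    have := congrArg norm (hi i)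
    simp only [norm_smul, norm_eq_of_mem_sphere, mul_one, Real.norm_eq_abs] at this
    rw [abs_of_pos (ρ i).2, abs_of_pos (ρ' i).2] at this
    exact Subtype.ext this
  subst hρ
  have hu : u = u' := by
    funext i
    exact Subtype.ext (smul_right_injective _ (ne_of_gt (ρ i).2) (hi i))
  rw [hu]

/-- An injective Borel map between standard Borel spaces is a measurable embedding (Lusin–Souslin).
-/
theorem measurableEmbedding_polarMap {d : ℕ} (hd : 1 ≤ d) : MeasurableEmbedding (polarMap d) := by
  have : StandardBorelSpace (Set.Ioi (0 : ℝ)) := measurableSet_Ioi.standardBorel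
  have : StandardBorelSpace (USphere d) := Metric.isClosed_sphere.measurableSet.standardBorel
  exact (measurePreserving_polarMap hd).measurable.measurableEmbedding (polarMap_injective d)

theorem radialMap_polarMap {d : ℕ} {r : ℝ}
    (q : (RSpace d × (Fin d → USphere d)) × (Fin d → Set.Ioi (0 : ℝ))) :
    radialMap d r (polarMap d q) =
      (WithLp.toLp 2 fun i => (q.2 i : ℝ) ^ d, sphereMap d r q.1) := by
  have h : ∀ i, ‖(q.2 i : ℝ) • (q.1.2 i : RSpace d)‖ = q.2 i := fun i => by
    rw [norm_smul, norm_eq_of_mem_sphere, mul_one, Real.norm_of_nonneg (le_of_lt (q.2 i).2)]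
  have h' : ∀ i, (q.2 i : ℝ) ≠ 0 := fun i => ne_of_gt (q.2 i).2
  simp only [radialMap, polarMap, h, smul_smul, mul_assoc, inv_mul_cancel₀ (h' _), mul_one]
  rfl

theorem polarMap_snd_ne_zero {d : ℕ}
    (q : (RSpace d × (Fin d → USphere d)) × (Fin d → Set.Ioi (0 : ℝ))) (i : Fin d) :
    (polarMap d q).2 i ≠ 0 :=
  smul_ne_zero (ne_of_gt (q.2 i).2) (ne_zero_of_mem_unit_sphere _)

theorem normalize_polarMap_snd {d : ℕ}
    (q : (RSpace d × (Fin d → USphere d)) × (Fin d → Set.Ioi (0 : ℝ))) (i : Fin d) :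
    ‖(polarMap d q).2 i‖⁻¹ • (polarMap d q).2 i = q.1.2 i := by
  have h : ‖(q.2 i : ℝ) • (q.1.2 i : RSpace d)‖ = q.2 i := by
    rw [norm_smul, norm_eq_of_mem_sphere, mul_one, Real.norm_of_nonneg (le_of_lt (q.2 i).2)]
  have h' : (q.2 i : ℝ) ≠ 0 := ne_of_gt (q.2 i).2
  simp only [polarMap, h, smul_smul, inv_mul_cancel₀ h', one_smul]

/-- The open unit cube in `ℝ^d`. -/
def openUnitCube (d : ℕ) : Set (RSpace d) := {s | ∀ i, s i ∈ Set.Ioo (0 : ℝ) 1}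

theorem volume_openUnitCube (d : ℕ) : volume (openUnitCube d) = 1 := by
  have h := (EuclideanSpace.volume_preserving_symm_measurableEquiv_toLp (Fin d)).measure_preimage_equiv
    (Set.univ.pi fun _ => Set.Ioo (0 : ℝ) 1)
  rw [volume_pi_pi] at h
  simp only [Real.volume_Ioo, sub_zero, ENNReal.ofReal_one, Finset.prod_const_one] at h
  rw [← h]
  congr 1
  ext s
  simp [openUnitCube]

/-- The set of radii in `(0, 1)`. -/
def unitRadii (d : ℕ) : Set (Fin d → Set.Ioi (0 : ℝ)) := 
  Set.univ.pi fun _ => Set.Iio ⟨1, Set.mem_Ioi.2 one_pos⟩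

theorem measurableSet_unitRadii (d : ℕ) : MeasurableSet (unitRadii d) :=
  MeasurableSet.univ_pi fun _ => measurableSet_Iio

theorem radialMeasure_unitRadii {d : ℕ} (hd : 1 ≤ d) :
    radialMeasure d (unitRadii d) = ENNReal.ofReal ((d : ℝ) ^ d)⁻¹ := by
  rw [radialMeasure, unitRadii, Measure.pi_pi]
  simp only [Measure.volumeIoiPow_apply_Iio, Finset.prod_const, Finset.card_univ, Fintype.card_fin,
    one_pow, Nat.cast_sub hd, Nat.cast_one, sub_add_cancel]
  rw [← ENNReal.ofReal_pow (by positivity), one_div, inv_pow]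

theorem image_radialMap_polarMap {d : ℕ} (hd : 1 ≤ d) (r : ℝ)
    (D : Set (RSpace d × (Fin d → USphere d))) :
    radialMap d r '' (polarMap d '' (D ×ˢ unitRadii d)) =
      openUnitCube d ×ˢ (sphereMap d r '' D) := by
  have hd0 : d ≠ 0 := by omega
  rw [Set.image_image]
  simp only [radialMap_polarMap]
  ext ⟨s, y⟩
  constructor
  · rintro ⟨⟨⟨z, u⟩, ρ⟩, ⟨hD, hρ⟩, h⟩
    obtain ⟨rfl, rfl⟩ := Prod.ext_iff.1 h
    refine ⟨fun i => ⟨pow_pos (ρ i).2 _, ?_⟩, (z, u), hD, rfl⟩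
    exact pow_lt_one₀ (le_of_lt (ρ i).2) (hρ i (Set.mem_univ i)) hd0
  · rintro ⟨hs, ⟨z, u⟩, hD, rfl⟩
    refine ⟨((z, u), fun i => ⟨s i ^ ((d : ℝ)⁻¹), Real.rpow_pos_of_pos (hs i).1 _⟩), ⟨hD, ?_⟩, ?_⟩
    · intro i _
      exact Real.rpow_lt_one (hs i).1.le (hs i).2 (by positivity)
    · refine Prod.ext ?_ rfl
      ext i
      exact Real.rpow_inv_natCast_pow (hs i).1.le hd0

/-! ### Change of variables and null sets -/

instance (d : ℕ) : (volume : Measure (RSpace d × (Fin d → RSpace d))).IsAddHaarMeasure := by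
  rw [Measure.volume_eq_prod]
  exact Measure.prod.instIsAddHaarMeasure _ _

theorem measurable_nablaVol (d : ℕ) : Measurable (nablaVol d) := by
  have h : nablaVol d = fun u => ENNReal.ofReal |Matrix.det fun i j => u i j| := by
    funext u
    rw [nablaVol_eq, ← LinearMap.det_toMatrix (EuclideanSpace.basisFun (Fin d) ℝ).toBasis]
    congr 3
    ext i j
    simp [LinearMap.toMatrix_apply, innerRows, EuclideanSpace.inner_single_right]
  rw [h]
  have hc : Continuous fun u : Fin d → RSpace d => Matrix.det fun i j => u i j :=
    Continuous.matrix_det (by fun_prop)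
  exact (ENNReal.continuous_ofReal.comp hc.abs).measurable

theorem measurable_sphereMap (d : ℕ) (r : ℝ) : Measurable (sphereMap d r) := by
  unfold sphereMap
  fun_prop

theorem measurable_nablaVol_sphere (d : ℕ) :
    Measurable fun p : RSpace d × (Fin d → USphere d) =>
      nablaVol d fun i => (p.2 i : RSpace d) :=
  (measurable_nablaVol d).comp (by fun_prop)

theorem lintegral_image_sphereMap {d : ℕ} (hd : 1 ≤ d) {r : ℝ} (hr : 0 < r)
    {D : Set (RSpace d × (Fin d → USphere d))} (hD : MeasurableSet D)
    (hT : Set.InjOn (sphereMap d r) D) {g : (Fin d → RSpace d) → ℝ≥0∞} (hg : Measurable g) :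
    ∫⁻ x in sphereMap d r '' D, g x = ENNReal.ofReal (r ^ (d * (d - 1))) *
      ∫⁻ p in D, g (sphereMap d r p) * nablaVol d (fun i => (p.2 i : RSpace d))
        ∂(volume.prod (sphereProdMeasure d)) := by
  have hemb := measurableEmbedding_polarMap hd
  have hS : MeasurableSet (polarMap d '' (D ×ˢ unitRadii d)) :=
    hemb.measurableSet_image.2 (hD.prod (measurableSet_unitRadii d))
  have hinj : Set.InjOn (radialMap d r) (polarMap d '' (D ×ˢ unitRadii d)) := by
    rintro _ ⟨⟨p, ρ⟩, ⟨hp, -⟩, rfl⟩ _ ⟨⟨p', ρ'⟩, ⟨hp', -⟩, rfl⟩ h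
    rw [radialMap_polarMap, radialMap_polarMap] at h
    obtain ⟨h1, h2⟩ := Prod.ext_iff.1 h
    obtain rfl : p = p' := hT hp hp' h2
    congr 2
    funext i
    have h3 : (ρ i : ℝ) ^ d = (ρ' i : ℝ) ^ d := congrArg (fun s : RSpace d => s i) h1
    exact Subtype.ext ((pow_left_inj₀ (le_of_lt (ρ i).2) (le_of_lt (ρ' i).2) (by omega)).1 h3)
  have harea := lintegral_image_eq_lintegral_abs_det_fderiv_mul
    (volume : Measure (RSpace d × (Fin d → RSpace d))) (f := radialMap d r)
    (f' := fderiv ℝ (radialMap d r)) hS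
    (by
      rintro _ ⟨q, -, rfl⟩
      exact (hasStrictFDerivAt_radialMap hr _
        (polarMap_snd_ne_zero q)).hasFDerivAt.hasFDerivWithinAt)
    hinj (fun y => g y.2)
  have hmeas : Measurable fun p : RSpace d × (Fin d → USphere d) =>
      g (sphereMap d r p) * nablaVol d (fun i => (p.2 i : RSpace d)) :=
    (hg.comp (measurable_sphereMap d r)).mul (measurable_nablaVol_sphere d)
  have hlhs : ∫⁻ y in radialMap d r '' (polarMap d '' (D ×ˢ unitRadii d)), g y.2 =
      ∫⁻ x in sphereMap d r '' D, g x := by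
    rw [image_radialMap_polarMap hd, Measure.volume_eq_prod, ← Measure.prod_restrict,
      lintegral_prod (fun y => g y.2) (hg.comp measurable_snd).aemeasurable]
    simp [volume_openUnitCube]
  have hrhs : ∫⁻ x in polarMap d '' (D ×ˢ unitRadii d),
        ENNReal.ofReal |(fderiv ℝ (radialMap d r) x).det| * g (radialMap d r x).2 =
      ENNReal.ofReal (r ^ (d * (d - 1))) *
      ∫⁻ p in D, g (sphereMap d r p) * nablaVol d (fun i => (p.2 i : RSpace d))
        ∂(volume.prod (sphereProdMeasure d)) := by
    rw [← (measurePreserving_polarMap hd).setLIntegral_comp_emb hemb]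
    have : ∀ q, ENNReal.ofReal |(fderiv ℝ (radialMap d r) (polarMap d q)).det| *
        g (radialMap d r (polarMap d q)).2 = ENNReal.ofReal (r ^ (d * (d - 1)) * d ^ d) *
        (g (sphereMap d r q.1) * nablaVol d (fun i => (q.1.2 i : RSpace d))) := fun q => by
      rw [abs_det_fderiv_radialMap hr _ (polarMap_snd_ne_zero q), radialMap_polarMap]
      simp only [normalize_polarMap_snd]
      rw [mul_assoc, mul_comm (nablaVol d _)]
    simp only [this]
    have hmeas' : Measurable fun q :
        (RSpace d × (Fin d → USphere d)) × (Fin d → Set.Ioi (0 : ℝ)) =>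
        g (sphereMap d r q.1) * nablaVol d (fun i => (q.1.2 i : RSpace d)) :=
      hmeas.comp measurable_fst
    rw [← Measure.prod_restrict, lintegral_const_mul _ hmeas', lintegral_prod _ hmeas'.aemeasurable]
    simp only [lintegral_const, Measure.restrict_apply MeasurableSet.univ, Set.univ_inter,
      radialMeasure_unitRadii hd]
    rw [lintegral_mul_const _ hmeas, ENNReal.ofReal_mul (by positivity), mul_assoc,
      mul_comm (∫⁻ _, _ ∂_), ← mul_assoc (ENNReal.ofReal ((d : ℝ) ^ d)),
      ← ENNReal.ofReal_mul (by positivity), mul_inv_cancel₀ (by positivity), ENNReal.ofReal_one,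
      one_mul]
  rw [← hlhs, harea, hrhs]

/-- Thickened by the radii, N stays null, and so does its differentiable image, the cube times T(N).
The cube has volume 1. -/
theorem volume_image_sphereMap_eq_zero {d : ℕ} (hd : 1 ≤ d) {r : ℝ} (hr : 0 < r)
    {N : Set (RSpace d × (Fin d → USphere d))}
    (hN : ((volume : Measure (RSpace d)).prod (sphereProdMeasure d)) N = 0) :
    volume (sphereMap d r '' N) = 0 := by
  have h1 : volume (polarMap d '' (N ×ˢ unitRadii d)) = 0 := by
    rw [← (measurePreserving_polarMap hd).measure_preimage_emb (measurableEmbedding_polarMap hd),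
      Set.preimage_image_eq _ (polarMap_injective d), Measure.prod_prod, hN, zero_mul]
  have h2 : volume (radialMap d r '' (polarMap d '' (N ×ˢ unitRadii d))) = 0 := by
    refine addHaar_image_eq_zero_of_differentiableOn_of_addHaar_eq_zero _ ?_ h1
    rintro _ ⟨q, -, rfl⟩
    exact (hasStrictFDerivAt_radialMap hr _
      (polarMap_snd_ne_zero q)).hasFDerivAt.differentiableAt.differentiableWithinAt
  rwa [image_radialMap_polarMap hd, Measure.volume_eq_prod, Measure.prod_prod,
    volume_openUnitCube, one_mul] at h2

theorem ae_sphereMap_of_nablaVol_ne_zero {d : ℕ} (hd : 1 ≤ d) {r : ℝ} (hr : 0 < r)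
    {P : (Fin d → RSpace d) → Prop} (hP : ∀ᵐ x, P x) :
    ∀ᵐ p ∂((volume : Measure (RSpace d)).prod (sphereProdMeasure d)),
      nablaVol d (fun i => (p.2 i : RSpace d)) ≠ 0 → P (sphereMap d r p) := by
  have hd' : (0 : ℝ) < d := by exact_mod_cast hd
  -- On the range of `polarMap` every component is nonzero, so `radialMap` is differentiable there.
  have h1 : volume ((Set.range (polarMap d) ∩ {x | (fderiv ℝ (radialMap d r) x).det ≠ 0}) ∩
      radialMap d r ⁻¹' (Set.univ ×ˢ {x | ¬ P x})) = 0 := by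
    refine measure_inter_preimage_eq_zero_of_det_ne_zero _ (f' := fderiv ℝ (radialMap d r))
      ?_ (fun x hx => hx.2) ?_
    · rintro _ ⟨⟨q, rfl⟩, -⟩
      exact hasStrictFDerivAt_radialMap hr _ (polarMap_snd_ne_zero q)
    · rw [Measure.volume_eq_prod, Measure.prod_prod, ae_iff.1 hP, mul_zero]
  have h2 := (measurePreserving_polarMap hd).quasiMeasurePreserving.preimage_null h1
  have h3 : ((volume.prod (sphereProdMeasure d)).prod (radialMeasure d))
      ({p | ¬ (nablaVol d (fun i => (p.2 i : RSpace d)) ≠ 0 → P (sphereMap d r p))} ×ˢ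
        unitRadii d) = 0 := by
    refine measure_mono_null ?_ h2
    rintro q ⟨hq, -⟩
    simp only [Set.mem_ofPred_eq, Classical.not_imp] at hq
    refine ⟨⟨⟨q, rfl⟩, ?_⟩, Set.mem_univ _, ?_⟩
    · intro h
      have h4 := abs_det_fderiv_radialMap hr _ (polarMap_snd_ne_zero q)
      simp only [normalize_polarMap_snd] at h4
      rw [h, abs_zero, ENNReal.ofReal_zero, eq_comm, mul_eq_zero, ENNReal.ofReal_eq_zero] at h4
      have h5 : 0 < r ^ (d * (d - 1)) * (d : ℝ) ^ d := by positivity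
      exact h4.elim (fun h4 => absurd h4 (not_le.2 h5)) hq.1
    · change ¬ P (radialMap d r (polarMap d q)).2
      rw [radialMap_polarMap]
      exact hq.2
  rw [Measure.prod_prod, mul_eq_zero, radialMeasure_unitRadii hd] at h3
  -- The radial factor has positive mass, so the other factor is null.
  exact h3.resolve_right (by rw [ENNReal.ofReal_eq_zero, not_le]; positivity)

theorem lemma2p1 (d : ℕ) (hd : 1 ≤ d) (r : ℝ) (hr : 0 < r)
    (D : Set (RSpace d × (Fin d → USphere d)))
    (hD : NullMeasurableSet D ((volume : Measure (RSpace d)).prod (sphereProdMeasure d)))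
    (hT : ∃ N : Set (RSpace d × (Fin d → USphere d)),
      ((volume : Measure (RSpace d)).prod (sphereProdMeasure d)) N = 0 ∧
        Set.InjOn (sphereMap d r) (D \ N))
    (f : (Fin d → RSpace d) → ℝ) (hf : AEMeasurable f volume) (hf0 : ∀ x, 0 ≤ f x) :
    ∫⁻ x in sphereMap d r '' D, ENNReal.ofReal (f x) =
      ENNReal.ofReal (r ^ (d * (d - 1))) *
        ∫⁻ z : RSpace d, ∫⁻ u : Fin d → USphere d,
          D.indicator 1 (z, u) * ENNReal.ofReal (f fun i => z + r • (u i : RSpace d)) *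
            nablaVol d (fun i => (u i : RSpace d)) ∂(sphereProdMeasure d) := by
  obtain ⟨N, hN, hinj⟩ := hT
  -- A Borel set of full measure in D on which T is injective; passing to it changes T(D) only by a
  -- null set.
  obtain ⟨D', hD'sub, hD'meas, hD'ae⟩ :=
    (hD.diff (NullMeasurableSet.of_null hN)).exists_measurable_subset_ae_eq
  have hae : D' =ᵐ[(volume : Measure (RSpace d)).prod (sphereProdMeasure d)] D :=
    hD'ae.trans (sdiff_null_ae_eq_self hN)
  have himage : (sphereMap d r '' D : Set (Fin d → RSpace d)) =ᵐ[volume] sphereMap d r '' D' := by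
    refine Filter.EventuallyLE.antisymm (ae_le_set.2 ?_)
      (Set.image_mono (hD'sub.trans Set.sdiff_subset)).eventuallyLE
    have hsub : sphereMap d r '' D \ sphereMap d r '' D' ⊆ sphereMap d r '' (D \ D') := by
      rintro _ ⟨⟨p, hp, rfl⟩, hp'⟩
      exact ⟨p, ⟨hp, fun h => hp' ⟨p, h, rfl⟩⟩, rfl⟩
    exact measure_mono_null hsub
      (volume_image_sphereMap_eq_zero hd hr (ae_le_set.1 hae.symm.le))
  have hfm : AEMeasurable (fun x => ENNReal.ofReal (f x)) volume := hf.ennreal_ofReal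
  let g := hfm.mk
  have hgm : Measurable g := hfm.measurable_mk
  have hfg : ∀ᵐ x, ENNReal.ofReal (f x) = g x := hfm.ae_eq_mk
  have hpt : ∀ᵐ p ∂((volume : Measure (RSpace d)).prod (sphereProdMeasure d)),
      D.indicator 1 p * ENNReal.ofReal (f (sphereMap d r p)) *
        nablaVol d (fun i => (p.2 i : RSpace d)) =
      D'.indicator (fun p => g (sphereMap d r p) * nablaVol d (fun i => (p.2 i : RSpace d))) p := by
    filter_upwards [ae_sphereMap_of_nablaVol_ne_zero hd hr hfg, hae.mem_iff] with p hp hpD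
    -- Where ∇_d = 0 the values of f and g along T need not agree, but both integrands vanish.
    by_cases h0 : nablaVol d (fun i => (p.2 i : RSpace d)) = 0
    · rw [h0, mul_zero, eq_comm, Set.indicator_apply_eq_zero]
      exact fun _ => by rw [h0, mul_zero]
    · rw [hp h0]
      by_cases hpD' : p ∈ D'
      · simp [Set.indicator_of_mem, hpD', hpD.1 hpD']
      · simp [hpD', mt hpD.2 hpD']
  have hmeas : Measurable fun p : RSpace d × (Fin d → USphere d) =>
      g (sphereMap d r p) * nablaVol d (fun i => (p.2 i : RSpace d)) :=
    (hgm.comp (measurable_sphereMap d r)).mul (measurable_nablaVol_sphere d)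
  rw [setLIntegral_congr himage, lintegral_congr_ae (ae_restrict_of_ae hfg),
    lintegral_image_sphereMap hd hr hD'meas (hinj.mono hD'sub) hgm,
    ← lintegral_indicator hD'meas, lintegral_prod _ (hmeas.indicator hD'meas).aemeasurable]
  congr 1
  refine lintegral_congr_ae ?_
  -- Tonelli was applied to the Borel version; the original integrand agrees with it on almost every
  -- slice.
  filter_upwards [Measure.ae_ae_of_ae_prod hpt] with z hz
  refine lintegral_congr_ae ?_
  filter_upwards [hz] with u hu
  exact hu.symm
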